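/- Let $R$ and $S$ be associative rings with unit (not necessarily commutative), and write $\operatorname{Mod} R$ for the class of left $R$-modules. Let $C={}_SC_R$ be a faithfully semidualizing $(S,R)$-bimodule, that is: - ${}_SC$ and $C_R$ each admit a resolution by finitely generated projective modules (over $S$ and over $R^{op}$, respectively); - the homothety maps $S\to\operatorname{Hom}_{R^{op}}(C,C)$, $s\mapsto(c\mapsto sc)$, and $R\to\operatorname{Hom}_S(C,C)$, $r\mapsto(c\mapsto cr)$, are isomorphisms; - $\operatorname{Ext}^i_S(C,C)=0=\operatorname{Ext}^i_{R^{op}}(C,C)$ for all $i\ge 1$; - for every left $S$-module $N$ and every right $R$-module $M$, if $\operatorname{Hom}_S(C,N)=0$ then $N=0$, and if $\operatorname{Hom}_{R^{op}}(C,M)=0$ then $M=0$. The Auslander class $\mathcal{A}_C(R)$ consists of all left $R$-modules $M$ such that $\operatorname{Tor}^R_i(C,M)=0$ and $\operatorname{Ext}_S^i(C,C\otimes_R M)=0$ for all $i\ge 1$, and the evaluation map $M\to\operatorname{Hom}_S(C,C\otimes_R M)$, $m\mapsto(c\mapsto c\otimes m)$, is an isomorphism. Set $[\mathcal{A}_C(R)]^1=\mathcal{A}_C(R)$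 and, for $n\ge 1$, let $[\mathcal{A}_C(R)]^{n+1}$ be the class of all left $R$-modules $M$ for which there is an exact sequence $$\cdots\to G_1\to G_0\to G^0\to G^1\to\cdots$$ of left $R$-modules, with all $G_i$ and $G^i$ in $[\mathcal{A}_C(R)]^n$, which remains exact after applying $C\otimes_R-$, and such that $M\cong\operatorname{coker}(G_1\to G_0)$. Theorem 4.7 (part of Theorem B). For every $n\ge 1$, $[\mathcal{A}_C(R)]^n=\mathcal{A}_C(R)$. -/

import Mathlib

open CategoryTheory CategoryTheory.Limits

open scoped TensorProduct

universe u

noncomputable section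

namespace Foxby

/-! Throughout, an `(S, R)`-bimodule `C` is an abelian group with a left `S`-module structure and a
right `R`-module structure (that is, a module over `Rᵐᵒᵖ`), the two actions commuting. -/

section Bimodule

variable (R S C : Type u) [Ring R] [Ring S] [AddCommGroup C]
  [Module S C] [Module Rᵐᵒᵖ C] [SMulCommClass S Rᵐᵒᵖ C]

/-! ### The tensor product `C ⊗_R M` over a noncommutative ring -/

/-- The subgroup of `C ⊗_ℤ M` generated by the elements `(c r) ⊗ m - c ⊗ (r m)`; it is stable
under the left action of `S` on `C`. -/
def balancing (M : Type u) [AddCommGroup M] [Module R M] : Submodule S (C ⊗[ℤ] M) where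
  __ := AddSubgroup.closure
    {x : C ⊗[ℤ] M | ∃ (c : C) (r : R) (m : M),
      x = (MulOpposite.op r • c) ⊗ₜ[ℤ] m - c ⊗ₜ[ℤ] (r • m)}
  smul_mem' := by
    intro s x hx
    change x ∈ AddSubgroup.closure _ at hx
    change s • x ∈ AddSubgroup.closure _
    induction hx using AddSubgroup.closure_induction with
    | mem x hx =>
      obtain ⟨c, r, m, rfl⟩ := hx
      refine AddSubgroup.subset_closure ⟨s • c, r, m, ?_⟩
      rw [smul_sub, TensorProduct.smul_tmul', TensorProduct.smul_tmul', smul_comm]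
    | zero => rw [smul_zero]; exact AddSubgroup.zero_mem _
    | add x y _ _ hx hy => rw [smul_add]; exact AddSubgroup.add_mem _ hx hy
    | neg x _ hx => rw [smul_neg]; exact AddSubgroup.neg_mem _ hx

/-- The left `S`-module `C ⊗_R M`, for an `(S, R)`-bimodule `C` and a left `R`-module `M`. -/
abbrev BiTensor (M : Type u) [AddCommGroup M] [Module R M] : Type u :=
  (C ⊗[ℤ] M) ⧸ balancing R S C M

/-- The elementary tensor `c ⊗ m` of `C ⊗_R M`. -/
def tmul {M : Type u} [AddCommGroup M] [Module R M] (c : C) (m : M) : BiTensor R S C M :=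
  Submodule.Quotient.mk (c ⊗ₜ[ℤ] m)

theorem tmul_add {M : Type u} [AddCommGroup M] [Module R M] (c : C) (m n : M) :
    tmul R S C c (m + n) = tmul R S C c m + tmul R S C c n := by
  simp only [tmul, TensorProduct.tmul_add, Submodule.Quotient.mk_add]

theorem add_tmul {M : Type u} [AddCommGroup M] [Module R M] (c d : C) (m : M) :
    tmul R S C (c + d) m = tmul R S C c m + tmul R S C d m := by
  simp only [tmul, TensorProduct.add_tmul, Submodule.Quotient.mk_add]

theorem smul_tmul {M : Type u} [AddCommGroup M] [Module R M] (s : S) (c : C) (m : M) :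
    tmul R S C (s • c) m = s • tmul R S C c m := by
  rw [tmul, tmul, ← Submodule.Quotient.mk_smul, TensorProduct.smul_tmul']

theorem op_smul_tmul {M : Type u} [AddCommGroup M] [Module R M] (r : R) (c : C) (m : M) :
    tmul R S C (MulOpposite.op r • c) m = tmul R S C c (r • m) :=
  (Submodule.Quotient.eq _).2 (AddSubgroup.subset_closure ⟨c, r, m, rfl⟩)

theorem biTensor_hom_ext {M N : Type u} [AddCommGroup M] [Module R M] [AddCommGroup N] [Module S N]
    {f g : BiTensor R S C M →ₗ[S] N}
    (h : ∀ c m, f (tmul R S C c m) = g (tmul R S C c m)) : f = g := by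
  refine Submodule.linearMap_qext _ (TensorProduct.AlgebraTensorModule.ext fun c m => ?_)
  exact h c m

/-- The map `C ⊗_R f : C ⊗_R M → C ⊗_R N` induced by an `R`-linear map `f : M → N`. -/
def biTensorMap {M N : Type u} [AddCommGroup M] [Module R M] [AddCommGroup N] [Module R N]
    (f : M →ₗ[R] N) : BiTensor R S C M →ₗ[S] BiTensor R S C N :=
  (balancing R S C M).mapQ (balancing R S C N)
    (TensorProduct.AlgebraTensorModule.lTensor S C (f.restrictScalars ℤ)) <| by
      intro x hx
      change x ∈ AddSubgroup.closure _ at hx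
      induction hx using AddSubgroup.closure_induction with
      | mem x hx =>
        obtain ⟨c, r, m, rfl⟩ := hx
        refine AddSubgroup.subset_closure ⟨c, r, f m, ?_⟩
        simp
      | zero => exact Submodule.zero_mem _
      | add x y _ _ hx hy => exact Submodule.add_mem _ hx hy
      | neg x _ hx => exact Submodule.neg_mem _ hx

@[simp]
theorem biTensorMap_tmul {M N : Type u} [AddCommGroup M] [Module R M] [AddCommGroup N] [Module R N]
    (f : M →ₗ[R] N) (c : C) (m : M) :
    biTensorMap R S C f (tmul R S C c m) = tmul R S C c (f m) := rfl

/-- The functor `C ⊗_R - : Mod R ⥤ Mod S`. -/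
def tensorFunctor : ModuleCat.{u} R ⥤ ModuleCat.{u} S where
  obj M := ModuleCat.of S (BiTensor R S C M)
  map f := ModuleCat.ofHom (biTensorMap R S C f.hom)
  map_id M := by
    refine ModuleCat.hom_ext (biTensor_hom_ext R S C fun c m => ?_)
    simp
  map_comp f g := by
    refine ModuleCat.hom_ext (biTensor_hom_ext R S C fun c m => ?_)
    simp

instance : (tensorFunctor R S C).Additive where
  map_add {M N f g} := by
    refine ModuleCat.hom_ext (biTensor_hom_ext R S C fun c m => ?_)
    exact tmul_add R S C c (f.hom m) (g.hom m)

/-! ### Semidualizing bimodules -/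

/-- A module over a ring `A` admits a degreewise finite projective resolution: a projective
resolution all of whose terms are finitely generated. -/
def HasDegreewiseFiniteProjectiveResolution (A : Type u) [Ring A] (M : Type u) [AddCommGroup M]
    [Module A M] : Prop :=
  ∃ P : ProjectiveResolution (ModuleCat.of A M), ∀ n, Module.Finite A (P.complex.X n)

/-- The homothety map `S → Hom_{Rᵒᵖ}(C, C)`, `s ↦ (c ↦ s c)`. -/
def homothetyLeft (s : S) : C →ₗ[Rᵐᵒᵖ] C where
  toFun c := s • c
  map_add' := smul_add s
  map_smul' r c := smul_comm s r c

/-- The homothety map `R → Hom_S(C, C)`, `r ↦ (c ↦ c r)`. -/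
def homothetyRight (r : R) : C →ₗ[S] C where
  toFun c := MulOpposite.op r • c
  map_add' := smul_add _
  map_smul' s c := (smul_comm s _ c).symm

/-- The `(S, R)`-bimodule `C` is semidualizing. -/
structure IsSemidualizing : Prop where
  resolution_left : HasDegreewiseFiniteProjectiveResolution S C
  resolution_right : HasDegreewiseFiniteProjectiveResolution Rᵐᵒᵖ C
  homothety_left : Function.Bijective (homothetyLeft R S C)
  homothety_right : Function.Bijective (homothetyRight R S C)
  ext_left : ∀ i : ℕ, 1 ≤ i →
    Subsingleton (Abelian.Ext (ModuleCat.of S C) (ModuleCat.of S C) i)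
  ext_right : ∀ i : ℕ, 1 ≤ i →
    Subsingleton (Abelian.Ext (ModuleCat.of Rᵐᵒᵖ C) (ModuleCat.of Rᵐᵒᵖ C) i)

/-- The `(S, R)`-bimodule `C` is faithfully semidualizing. -/
structure IsFaithfullySemidualizing : Prop extends IsSemidualizing R S C where
  faithful_left : ∀ (N : Type u) [AddCommGroup N] [Module S N],
    (∀ f : C →ₗ[S] N, f = 0) → Subsingleton N
  faithful_right : ∀ (M : Type u) [AddCommGroup M] [Module Rᵐᵒᵖ M],
    (∀ f : C →ₗ[Rᵐᵒᵖ] M, f = 0) → Subsingleton M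

/-! ### The Auslander class and its iterates -/

/-- The natural evaluation homomorphism `μ_M : M → Hom_S(C, C ⊗_R M)`, `m ↦ (c ↦ c ⊗ m)`. -/
def evaluation (M : Type u) [AddCommGroup M] [Module R M] : M →+ (C →ₗ[S] BiTensor R S C M) where
  toFun m :=
    { toFun := fun c => tmul R S C c m
      map_add' := fun c d => add_tmul R S C c d m
      map_smul' := fun s c => smul_tmul R S C s c m }
  map_zero' := by
    ext c
    simp [tmul]
  map_add' m n := by
    ext c
    exact tmul_add R S C c m n

/-- The evaluation homomorphism is `R`-linear for the usual left `R`-module structure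
`(r f)(c) = f (c r)` on `Hom_S(C, -)`; so it is an isomorphism of left `R`-modules if and only if
it is bijective. -/
theorem evaluation_smul (M : Type u) [AddCommGroup M] [Module R M] (r : R) (m : M) (c : C) :
    evaluation R S C M (r • m) c = evaluation R S C M m (MulOpposite.op r • c) :=
  (op_smul_tmul R S C r c m).symm

/-- Membership in the Auslander class `𝒜_C(R)`. Here `Tor_i^R(C, -)` is the `i`-th left derived
functor of `C ⊗_R -`. -/
structure IsAuslander (M : ModuleCat.{u} R) : Prop where
  tor : ∀ i : ℕ, 1 ≤ i → IsZero (((tensorFunctor R S C).leftDerived i).obj M)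
  ext : ∀ i : ℕ, 1 ≤ i →
    Subsingleton (Abelian.Ext (ModuleCat.of S C) ((tensorFunctor R S C).obj M) i)
  eval : Function.Bijective (evaluation R S C M)

/-- The Auslander class `𝒜_C(R)`, a class of left `R`-modules. -/
def auslanderClass : ObjectProperty (ModuleCat.{u} R) := fun M => IsAuslander R S C M

/-- The class of all modules `M ≅ coker (X₁ ⟶ X₀)`, where
`⋯ ⟶ X₁ ⟶ X₀ ⟶ X₋₁ ⟶ X₋₂ ⟶ ⋯` is an exact sequence of left `R`-modules in the class `𝒳`, which
stays exact under `C ⊗_R -`. -/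
def completeCokernels (𝒳 : ObjectProperty (ModuleCat.{u} R)) : ObjectProperty (ModuleCat.{u} R) :=
  fun M => ∃ X : ChainComplex (ModuleCat.{u} R) ℤ,
    (∀ i : ℤ, 𝒳 (X.X i)) ∧
    X.Acyclic ∧
    (((tensorFunctor R S C).mapHomologicalComplex (ComplexShape.down ℤ)).obj X).Acyclic ∧
    Nonempty (M ≅ cokernel (X.d 1 0))

/-- The iterates `[𝒜_C(R)]ⁿ` for `n ≥ 1` (the value at `n = 0` is a placeholder without meaning):
`[𝒜_C(R)]¹ = 𝒜_C(R)`, and `[𝒜_C(R)]ⁿ⁺¹` consists of the cokernels in `C ⊗_R -` exact exact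
sequences with terms in `[𝒜_C(R)]ⁿ`. -/
def auslanderIterate : ℕ → ObjectProperty (ModuleCat.{u} R)
  | 0 => ⊥
  | 1 => auslanderClass R S C
  | n + 2 => completeCokernels R S C (auslanderIterate (n + 1))

end Bimodule

end Foxby

end

/-! It suffices that one round of the construction gives nothing new; induction on `n` does the
rest. Each `M` in the class is the cokernel of a contractible complex built from the identity of
`M`. Conversely, cut a `C ⊗_R -` exact complex into sequences `0 → Z (i + 1) → X i → Z i → 0` that
stay short exact under `C ⊗_R -`, and prove the three Auslander conditions for all `Z i` at once, so
that each syzygy can use its neighbours (`TensorExactSyzygies.isAuslander`). Evaluation: a diagram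
chase in the naturality square of `Z (i + 1) → X i` gives injectivity for every syzygy, and then
surjectivity. Ext: surjectivity of evaluation on `Z i` lifts every map `C → C ⊗ Z i` to `C ⊗ X i`,
which kills `Ext¹(C, C ⊗ Z (i + 1))`; higher degrees follow by dimension shifting. Tor: `Tor_i(C,
-)` and `Ext^i(-, Hom_ℤ(C, ℚ/ℤ))` vanish together for `i ≥ 1` (`isZero_leftDerived_iff`), because
`ℚ/ℤ` is an injective cogenerator. Dimension shifting then starts from the injectivity of `C ⊗ Z (i
+ 1) → C ⊗ X i`. -/

noncomputable section

namespace Foxby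

/-! ### Characters -/

section Characters

variable {A B D : Type*} [AddCommGroup A] [AddCommGroup B] [AddCommGroup D]

/-- `ℚ/ℤ` is injective: a character vanishing on the kernel of `f` factors through `f`. -/
theorem exists_character_comp_eq (f : A →+ B) (φ : A →+ AddCircle (1 : ℚ))
    (h : ∀ a, f a = 0 → φ a = 0) : ∃ ψ : B →+ AddCircle (1 : ℚ), ∀ a, ψ (f a) = φ a := by
  have hφ : f.ker ≤ φ.ker := fun a ha => h a ha
  -- Injectivity extends only along monomorphisms, so both maps are first passed to `A / ker f`.
  obtain ⟨ψ, hψ⟩ := (Module.Baer.of_divisible (AddCircle (1 : ℚ))).extension_property_addMonoidHom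
    (QuotientAddGroup.kerLift f) (QuotientAddGroup.kerLift_injective f)
    (QuotientAddGroup.lift f.ker φ hφ)
  exact ⟨ψ, fun a => DFunLike.congr_fun hψ (a : A ⧸ f.ker)⟩

/-- `ℚ/ℤ` is an injective cogenerator: exactness can be tested on characters. -/
theorem exact_iff_characters (f : A →+ B) (g : B →+ D) (hgf : ∀ a, g (f a) = 0) :
    Function.Exact f g ↔ ∀ φ : B →+ AddCircle (1 : ℚ), (∀ a, φ (f a) = 0) →
      ∃ ψ : D →+ AddCircle (1 : ℚ), ∀ b, ψ (g b) = φ b := by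
  constructor
  · intro hex φ hφ
    refine exists_character_comp_eq g φ fun b hb => ?_
    obtain ⟨a, rfl⟩ := (hex b).1 hb
    exact hφ a
  · intro h b
    refine ⟨fun hb => ?_, by rintro ⟨a, rfl⟩; exact hgf a⟩
    by_contra hnot
    -- A character of `B / f(A)` not vanishing at `b` factors through `g` by hypothesis,
    -- contradicting `g b = 0`.
    have hne : (QuotientAddGroup.mk b : B ⧸ f.range) ≠ 0 := fun h0 =>
      hnot ((QuotientAddGroup.eq_zero_iff b).1 h0)
    obtain ⟨c, hc⟩ := CharacterModule.exists_character_apply_ne_zero_of_ne_zero hne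
    let c' : (B ⧸ f.range) →+ AddCircle (1 : ℚ) := c
    obtain ⟨ψ, hψ⟩ := h (c'.comp (QuotientAddGroup.mk' f.range)) fun a => by
      have : QuotientAddGroup.mk' f.range (f a) = 0 :=
        (QuotientAddGroup.eq_zero_iff _).2 ⟨a, rfl⟩
      rw [AddMonoidHom.comp_apply, this, map_zero]
    apply hc
    have := hψ b
    rw [hb, map_zero] at this
    exact this.symm

end Characters

/-! ### Duality between `C ⊗_R -` and maps into the character module -/

section Bimodule

variable (R S C : Type u) [Ring R] [Ring S] [AddCommGroup C]
  [Module S C] [Module Rᵐᵒᵖ C] [SMulCommClass S Rᵐᵒᵖ C]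

/-- The character module `Hom_ℤ(C, ℚ/ℤ)` of a right `R`-module, as a left `R`-module. -/
def CharacterDual (_R C : Type u) [Ring _R] [AddCommGroup C] [Module _Rᵐᵒᵖ C] : Type u :=
  C →+ AddCircle (1 : ℚ)

instance : AddCommGroup (CharacterDual R C) :=
  inferInstanceAs (AddCommGroup (C →+ AddCircle (1 : ℚ)))

instance : FunLike (CharacterDual R C) C (AddCircle (1 : ℚ)) :=
  inferInstanceAs (FunLike (C →+ AddCircle (1 : ℚ)) C (AddCircle (1 : ℚ)))

instance : AddMonoidHomClass (CharacterDual R C) C (AddCircle (1 : ℚ)) :=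
  inferInstanceAs (AddMonoidHomClass (C →+ AddCircle (1 : ℚ)) C (AddCircle (1 : ℚ)))

variable {R C} in
@[ext]
theorem CharacterDual.ext {f g : CharacterDual R C} (h : ∀ c, f c = g c) : f = g :=
  DFunLike.ext f g h

variable {R C} in
@[simp]
theorem CharacterDual.add_apply (f g : CharacterDual R C) (c : C) : (f + g) c = f c + g c := rfl

variable {R C} in
@[simp]
theorem CharacterDual.zero_apply (c : C) : (0 : CharacterDual R C) c = 0 := rfl

instance : SMul R (CharacterDual R C) where
  smul r f := AddMonoidHom.comp (f : C →+ AddCircle (1 : ℚ))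
    (DistribSMul.toAddMonoidHom C (MulOpposite.op r))

variable {R C} in
@[simp]
theorem CharacterDual.smul_apply (r : R) (f : CharacterDual R C) (c : C) :
    (r • f) c = f (MulOpposite.op r • c) := rfl

instance : Module R (CharacterDual R C) where
  one_smul f := by ext; simp
  mul_smul r s f := by ext; simp [mul_smul]
  smul_zero r := by ext; simp
  smul_add r f g := by ext; simp
  add_smul r s f := by ext; simp [add_smul]
  zero_smul f := by ext; simp

variable {M N L : Type u} [AddCommGroup M] [Module R M] [AddCommGroup N] [Module R N]
  [AddCommGroup L] [Module R L]

theorem biTensor_induction {p : BiTensor R S C M → Prop} (x : BiTensor R S C M)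
    (zero : p 0) (tmul : ∀ c m, p (tmul R S C c m)) (add : ∀ x y, p x → p y → p (x + y)) : p x := by
  obtain ⟨x, rfl⟩ := Submodule.Quotient.mk_surjective _ x
  induction x using TensorProduct.induction_on with
  | zero => exact zero
  | tmul c m => exact tmul c m
  | add x y hx hy => exact add _ _ hx hy

/-- The universal property of `C ⊗_R M` for maps to `ℚ/ℤ`: a linear map `M → Hom_ℤ(C, ℚ/ℤ)`
induces a character of `C ⊗_R M`. -/
def characterOfHom (f : M →ₗ[R] CharacterDual R C) :
    BiTensor R S C M →+ AddCircle (1 : ℚ) :=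
  QuotientAddGroup.lift (balancing R S C M).toAddSubgroup
    (TensorProduct.liftAddHom
      (AddMonoidHom.flip (f.toAddMonoidHom : M →+ (C →+ AddCircle (1 : ℚ))))
      fun n c m => by
        simp only [map_zsmul, AddMonoidHom.coe_smul, Pi.smul_apply]) <| by
    intro x hx
    change x ∈ AddSubgroup.closure _ at hx
    induction hx using AddSubgroup.closure_induction with
    | mem x hx =>
      obtain ⟨c, r, m, rfl⟩ := hx
      rw [AddMonoidHom.mem_ker, map_sub, sub_eq_zero, TensorProduct.liftAddHom_tmul,
        TensorProduct.liftAddHom_tmul]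
      change f m (MulOpposite.op r • c) = f (r • m) c
      rw [f.map_smul, CharacterDual.smul_apply]
    | zero => exact AddSubgroup.zero_mem _
    | add x y _ _ hx hy => exact AddSubgroup.add_mem _ hx hy
    | neg x _ hx => exact AddSubgroup.neg_mem _ hx

/-- The linear map `M → Hom_ℤ(C, ℚ/ℤ)` attached to a character of `C ⊗_R M`. -/
def homOfCharacter (φ : BiTensor R S C M →+ AddCircle (1 : ℚ)) :
    M →ₗ[R] CharacterDual R C where
  toFun m := AddMonoidHom.mk' (fun c => φ (tmul R S C c m)) fun c d => by
    rw [add_tmul, map_add]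
  map_add' m n := by
    ext c
    exact (congrArg φ (tmul_add R S C c m n)).trans (map_add φ _ _)
  map_smul' r m := by
    ext c
    exact congrArg φ (op_smul_tmul R S C r c m).symm

/-- `C ⊗_R -` sends `f, g` to an exact sequence if and only if `Hom_R(-, Hom_ℤ(C, ℚ/ℤ))` does. -/
theorem biTensorMap_exact_iff (f : M →ₗ[R] N) (g : N →ₗ[R] L) (hgf : g ∘ₗ f = 0) :
    Function.Exact (biTensorMap R S C f) (biTensorMap R S C g) ↔
      ∀ φ : N →ₗ[R] CharacterDual R C, φ ∘ₗ f = 0 →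
        ∃ ψ : L →ₗ[R] CharacterDual R C, ψ ∘ₗ g = φ := by
  have hgf' (x) : biTensorMap R S C g (biTensorMap R S C f x) = 0 := by
    induction x using biTensor_induction with
    | zero => simp
    | tmul c m =>
      have : g (f m) = 0 := LinearMap.congr_fun hgf m
      rw [biTensorMap_tmul, biTensorMap_tmul, this]
      simp [tmul]
    | add x y hx hy => rw [map_add, map_add, hx, hy, add_zero]
  refine (exact_iff_characters (biTensorMap R S C f).toAddMonoidHom
    (biTensorMap R S C g).toAddMonoidHom hgf').trans ⟨fun h φ hφ => ?_, fun h φ hφ => ?_⟩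
  · obtain ⟨ψ, hψ⟩ := h (characterOfHom R S C φ) fun x => by
      induction x using biTensor_induction with
      | zero => simp
      | tmul c m => exact DFunLike.congr_fun (LinearMap.congr_fun hφ m) c
      | add x y hx hy => rw [map_add, map_add, hx, hy, add_zero]
    refine ⟨homOfCharacter R S C ψ, ?_⟩
    ext n c
    exact hψ (tmul R S C c n)
  · obtain ⟨ψ, hψ⟩ := h (homOfCharacter R S C φ) <| by
      ext m c
      exact hφ (tmul R S C c m)
    refine ⟨characterOfHom R S C ψ, fun x => ?_⟩
    induction x using biTensor_induction with
    | zero => simp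
    | tmul c m => exact DFunLike.congr_fun (LinearMap.congr_fun hψ m) c
    | add x y hx hy => rw [map_add, map_add, map_add, hx, hy]

/-- If `C ⊗_R f` is injective, then maps to `Hom_ℤ(C, ℚ/ℤ)` extend along `f`. -/
theorem exists_comp_eq_of_biTensorMap_injective (f : M →ₗ[R] N)
    (hf : Function.Injective (biTensorMap R S C f)) (φ : M →ₗ[R] CharacterDual R C) :
    ∃ ψ : N →ₗ[R] CharacterDual R C, ψ ∘ₗ f = φ := by
  obtain ⟨ψ, hψ⟩ := exists_character_comp_eq (biTensorMap R S C f).toAddMonoidHom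
    (characterOfHom R S C φ) fun x hx => by
      rw [hf (hx.trans (map_zero _).symm), map_zero]
  refine ⟨homOfCharacter R S C ψ, ?_⟩
  ext m c
  exact hψ (tmul R S C c m)

/-! ### Right exactness of the tensor product -/

theorem biTensorMap_surjective {g : N →ₗ[R] L} (hg : Function.Surjective g) :
    Function.Surjective (biTensorMap R S C g) := by
  intro x
  induction x using biTensor_induction with
  | zero => exact ⟨0, map_zero _⟩
  | tmul c l =>
    obtain ⟨n, rfl⟩ := hg l
    exact ⟨tmul R S C c n, rfl⟩
  | add x y hx hy =>
    obtain ⟨x', rfl⟩ := hx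
    obtain ⟨y', rfl⟩ := hy
    exact ⟨x' + y', map_add _ _ _⟩

/-- By duality this only asks that a map killing the image of `f` factor through `g`, which holds
since `L ≅ N / ker g`. -/
theorem biTensorMap_exact {f : M →ₗ[R] N} {g : N →ₗ[R] L} (hfg : Function.Exact f g)
    (hg : Function.Surjective g) :
    Function.Exact (biTensorMap R S C f) (biTensorMap R S C g) := by
  have hgf : g ∘ₗ f = 0 := hfg.linearMap_comp_eq_zero
  refine (biTensorMap_exact_iff R S C f g hgf).2 fun φ hφ => ?_
  have hker : LinearMap.ker g ≤ LinearMap.ker φ := by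
    intro n hn
    obtain ⟨m, rfl⟩ := (hfg n).1 hn
    exact LinearMap.congr_fun hφ m
  refine ⟨(LinearMap.ker g).liftQ φ hker ∘ₗ (g.quotKerEquivOfSurjective hg).symm.toLinearMap, ?_⟩
  ext n : 1
  have : (g.quotKerEquivOfSurjective hg).symm (g n) = Submodule.Quotient.mk n := by
    rw [LinearEquiv.symm_apply_eq]; rfl
  simp [this]

end Bimodule

/-! ### Dimension shifting -/

section DimensionShifting

variable {𝒜 : Type*} [Category 𝒜] [Abelian 𝒜] [HasExt.{u} 𝒜] {T : ShortComplex 𝒜}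

/-- Base case of the shifting: `Hom` need not vanish, so surjectivity of `Hom(Y, X₂) → Hom(Y, X₃)`
replaces vanishing; it makes the connecting map zero. -/
theorem subsingleton_ext_one_of_forall_exists_lift (hT : T.ShortExact) (Y : 𝒜)
    (h₂ : Subsingleton (Abelian.Ext Y T.X₂ 1)) (h : ∀ φ : Y ⟶ T.X₃, ∃ ψ : Y ⟶ T.X₂, ψ ≫ T.g = φ) :
    Subsingleton (Abelian.Ext Y T.X₁ 1) := by
  suffices key : ∀ α : Abelian.Ext Y T.X₁ 1, α = 0 from ⟨fun a b => (key a).trans (key b).symm⟩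
  intro α
  obtain ⟨β, rfl⟩ := Abelian.Ext.covariant_sequence_exact₁ _ hT α (h₂.elim _ _) (n₀ := 0) rfl
  obtain ⟨φ, rfl⟩ := (Abelian.Ext.mk₀_bijective _ _).2 β
  obtain ⟨ψ, rfl⟩ := h φ
  rw [← Abelian.Ext.mk₀_comp_mk₀, Abelian.Ext.comp_assoc_of_second_deg_zero, hT.comp_extClass,
    Abelian.Ext.comp_zero]

theorem subsingleton_ext_succ_left (hT : T.ShortExact) (Y : 𝒜) (n : ℕ)
    (h₂ : Subsingleton (Abelian.Ext Y T.X₂ (n + 1))) (h₃ : Subsingleton (Abelian.Ext Y T.X₃ n)) :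
    Subsingleton (Abelian.Ext Y T.X₁ (n + 1)) := by
  suffices key : ∀ α : Abelian.Ext Y T.X₁ (n + 1), α = 0 from
    ⟨fun a b => (key a).trans (key b).symm⟩
  intro α
  obtain ⟨β, rfl⟩ := Abelian.Ext.covariant_sequence_exact₁ _ hT α (h₂.elim _ _) (n₀ := n) rfl
  rw [h₃.elim β 0, Abelian.Ext.zero_comp]

theorem subsingleton_ext_one_of_forall_exists_extension (hT : T.ShortExact) (Y : 𝒜)
    (h₂ : Subsingleton (Abelian.Ext T.X₂ Y 1)) (h : ∀ φ : T.X₁ ⟶ Y, ∃ ψ : T.X₂ ⟶ Y, T.f ≫ ψ = φ) :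
    Subsingleton (Abelian.Ext T.X₃ Y 1) := by
  suffices key : ∀ α : Abelian.Ext T.X₃ Y 1, α = 0 from ⟨fun a b => (key a).trans (key b).symm⟩
  intro α
  obtain ⟨β, rfl⟩ := Abelian.Ext.contravariant_sequence_exact₃ hT _ α (h₂.elim _ _) (n₀ := 0) rfl
  obtain ⟨φ, rfl⟩ := (Abelian.Ext.mk₀_bijective _ _).2 β
  obtain ⟨ψ, rfl⟩ := h φ
  rw [← Abelian.Ext.mk₀_comp_mk₀, hT.extClass_comp_assoc]

theorem subsingleton_ext_succ_right (hT : T.ShortExact) (Y : 𝒜) (n : ℕ)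
    (h₂ : Subsingleton (Abelian.Ext T.X₂ Y (n + 1))) (h₁ : Subsingleton (Abelian.Ext T.X₁ Y n)) :
    Subsingleton (Abelian.Ext T.X₃ Y (n + 1)) := by
  suffices key : ∀ α : Abelian.Ext T.X₃ Y (n + 1), α = 0 from
    ⟨fun a b => (key a).trans (key b).symm⟩
  intro α
  obtain ⟨β, rfl⟩ := Abelian.Ext.contravariant_sequence_exact₃ hT _ α (h₂.elim _ _) (n₀ := n)
    (add_comm 1 n)
  rw [h₁.elim β 0, Abelian.Ext.comp_zero]

end DimensionShifting

/-! ### Vanishing of Tor as vanishing of Ext -/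

section Bimodule

variable (R S C : Type u) [Ring R] [Ring S] [AddCommGroup C]
  [Module S C] [Module Rᵐᵒᵖ C] [SMulCommClass S Rᵐᵒᵖ C]

/-- `Tor_{i+1}^R(C, M) = 0` if and only if `Ext^{i+1}_R(M, Hom_ℤ(C, ℚ/ℤ)) = 0`. -/
theorem isZero_leftDerived_iff (M : ModuleCat.{u} R) (i : ℕ) :
    IsZero (((tensorFunctor R S C).leftDerived (i + 1)).obj M) ↔
      Subsingleton (Abelian.Ext M (ModuleCat.of R (CharacterDual R C)) (i + 1)) := by
  obtain ⟨P⟩ : Nonempty (ProjectiveResolution M) := HasProjectiveResolution.out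
  rw [(P.isoLeftDerivedObj (tensorFunctor R S C) (i + 1)).isZero_iff]
  change IsZero (HomologicalComplex.homology _ (i + 1)) ↔ _
  rw [← HomologicalComplex.exactAt_iff_isZero_homology,
    HomologicalComplex.exactAt_iff' _ (i + 2) (i + 1) i (by simp) (by simp),
    ShortComplex.ShortExact.moduleCat_exact_iff_function_exact]
  -- The dual form of exactness says that every cocycle `P_{i+1} → Hom_ℤ(C, ℚ/ℤ)` is a coboundary,
  -- which is the vanishing of Ext computed from `P`.
  refine (biTensorMap_exact_iff R S C (P.complex.d (i + 2) (i + 1)).hom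
    (P.complex.d (i + 1) i).hom ?_).trans ⟨fun h => ?_, fun h φ hφ => ?_⟩
  · rw [← ModuleCat.hom_comp, P.complex.d_comp_d]; rfl
  · suffices ∀ α : Abelian.Ext M (ModuleCat.of R (CharacterDual R C)) (i + 1), α = 0 from
      ⟨fun a b => (this a).trans (this b).symm⟩
    intro α
    obtain ⟨f, hf, rfl⟩ := P.extMk_surjective α (i + 2) rfl
    obtain ⟨ψ, hψ⟩ := h f.hom (by rw [← ModuleCat.hom_comp, hf]; rfl)
    exact (P.extMk_eq_zero_iff f _ rfl hf i rfl).2 ⟨ModuleCat.ofHom ψ, ModuleCat.hom_ext hψ⟩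
  · obtain ⟨g, hg⟩ := (P.extMk_eq_zero_iff (ModuleCat.ofHom φ) (i + 2) rfl
      (ModuleCat.hom_ext hφ) i rfl).1 (Subsingleton.elim _ _)
    exact ⟨g.hom, congrArg ModuleCat.Hom.hom hg⟩

variable {R S C} in
theorem evaluation_map {M N : Type u} [AddCommGroup M] [Module R M] [AddCommGroup N] [Module R N]
    (f : M →ₗ[R] N) (m : M) :
    evaluation R S C N (f m) = biTensorMap R S C f ∘ₗ evaluation R S C M m := rfl

/-! ### Closure properties of the Auslander class -/

theorem IsAuslander.of_iso {M N : ModuleCat.{u} R} (e : M ≅ N) (hM : IsAuslander R S C M) :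
    IsAuslander R S C N where
  tor i hi := (hM.tor i hi).of_iso (((tensorFunctor R S C).leftDerived i).mapIso e.symm)
  ext i hi := by
    have := hM.ext i hi
    let e' := (tensorFunctor R S C).mapIso e
    have key (α : Abelian.Ext (ModuleCat.of S C) ((tensorFunctor R S C).obj N) i) : α = 0 := by
      have h0 : α.comp (Abelian.Ext.mk₀ e'.inv) (add_zero i) = 0 := Subsingleton.elim _ _
      have h1 := congrArg (fun β => β.comp (Abelian.Ext.mk₀ e'.hom) (add_zero i)) h0
      simpa using h1
    exact ⟨fun a b => (key a).trans (key b).symm⟩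
  eval := by
    have hinv (y : N) : e.hom.hom (e.inv.hom y) = y :=
      LinearMap.congr_fun (congrArg ModuleCat.Hom.hom e.inv_hom_id) y
    have hinv' (y : M) : e.inv.hom (e.hom.hom y) = y :=
      LinearMap.congr_fun (congrArg ModuleCat.Hom.hom e.hom_inv_id) y
    have hT (x : BiTensor R S C N) :
        biTensorMap R S C e.hom.hom (biTensorMap R S C e.inv.hom x) = x := by
      induction x using biTensor_induction with
      | zero => simp only [map_zero]
      | tmul c m => rw [biTensorMap_tmul, biTensorMap_tmul, hinv]
      | add x y hx hy => simp only [map_add, hx, hy]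
    constructor
    · intro x y hxy
      have := congrArg (fun φ => biTensorMap R S C e.inv.hom ∘ₗ φ) hxy
      simp only [← evaluation_map] at this
      rw [← hinv x, ← hinv y, hM.eval.1 this]
    · intro φ
      obtain ⟨m, hm⟩ := hM.eval.2 (biTensorMap R S C e.inv.hom ∘ₗ φ)
      refine ⟨e.hom.hom m, ?_⟩
      rw [evaluation_map, hm]
      ext c
      exact hT (φ c)

theorem IsAuslander.of_isZero {M : ModuleCat.{u} R} (hM : IsZero M) : IsAuslander R S C M where
  tor i hi := by
    obtain ⟨i, rfl⟩ := Nat.exists_eq_add_of_le' hi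
    have : Projective M := hM.projective
    exact Functor.isZero_leftDerived_obj_projective_succ _ i M
  ext i _ := by
    have h0 : IsZero ((tensorFunctor R S C).obj M) := Functor.map_isZero _ hM
    have key (α : Abelian.Ext (ModuleCat.of S C) ((tensorFunctor R S C).obj M) i) : α = 0 := by
      rw [← α.comp_mk₀_id, h0.eq_zero_of_src (𝟙 _), Abelian.Ext.mk₀_zero, Abelian.Ext.comp_zero]
    exact ⟨fun a b => (key a).trans (key b).symm⟩
  eval := by
    have h0 : IsZero ((tensorFunctor R S C).obj M) := Functor.map_isZero _ hM
    have hs : Subsingleton M := ModuleCat.subsingleton_of_isZero hM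
    have hs' : Subsingleton (BiTensor R S C M) := ModuleCat.subsingleton_of_isZero h0
    exact ⟨fun _ _ _ => Subsingleton.elim _ _,
      fun φ => ⟨0, LinearMap.ext fun _ => Subsingleton.elim _ _⟩⟩

/-! ### Syzygies in complete resolutions -/

/-- Short exact sequences `0 ⟶ Z (i + 1) ⟶ X i ⟶ Z i ⟶ 0`, `i ∈ ℤ`, which stay exact under
`C ⊗_R -`: a `C ⊗_R -` exact acyclic complex, cut into pieces. -/
structure TensorExactSyzygies (X Z : ℤ → ModuleCat.{u} R) where
  ι (i : ℤ) : Z (i + 1) ⟶ X i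
  π (i : ℤ) : X i ⟶ Z i
  zero (i : ℤ) : ι i ≫ π i = 0
  shortExact (i : ℤ) : (ShortComplex.mk (ι i) (π i) (zero i)).ShortExact
  injective_tensor (i : ℤ) : Function.Injective (biTensorMap R S C (ι i).hom)

namespace TensorExactSyzygies

variable {R S C} {X Z : ℤ → ModuleCat.{u} R} (h : TensorExactSyzygies R S C X Z)
include h

theorem tensor_shortExact (i : ℤ) :
    ((ShortComplex.mk (h.ι i) (h.π i) (h.zero i)).map (tensorFunctor R S C)).ShortExact := by
  have hs := (h.shortExact i).moduleCat_surjective_g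
  have hex := (ShortComplex.ShortExact.moduleCat_exact_iff_function_exact _).1 (h.shortExact i).exact
  refine ModuleCat.shortComplex_shortExact _ ?_ (h.injective_tensor i) ?_
  · exact biTensorMap_exact R S C hex hs
  · exact biTensorMap_surjective R S C hs

/-- This is the Tor condition in dual form. Degree one uses extension along `ι`; each further degree
passes from `Z i` to `Z (i + 1)`. -/
theorem subsingleton_ext_characterDual (hX : ∀ i, IsAuslander R S C (X i)) (j : ℕ) (i : ℤ) :
    Subsingleton (Abelian.Ext (Z i) (ModuleCat.of R (CharacterDual R C)) (j + 1)) := by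
  have hXi := (isZero_leftDerived_iff R S C (X i) j).1 ((hX i).tor _ (by omega))
  induction j generalizing i with
  | zero =>
    refine subsingleton_ext_one_of_forall_exists_extension (h.shortExact i) _ hXi fun φ => ?_
    obtain ⟨ψ, hψ⟩ := exists_comp_eq_of_biTensorMap_injective R S C (h.ι i).hom
      (h.injective_tensor i) φ.hom
    exact ⟨ModuleCat.ofHom ψ, ModuleCat.hom_ext hψ⟩
  | succ j ih =>
    exact subsingleton_ext_succ_right (h.shortExact i) _ _ hXi <| ih (i + 1) <|
      (isZero_leftDerived_iff R S C (X (i + 1)) j).1 ((hX (i + 1)).tor _ (by omega))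

theorem evaluation_injective (hX : ∀ i, IsAuslander R S C (X i)) (i : ℤ) :
    Function.Injective (evaluation R S C (Z (i + 1))) := by
  intro x y hxy
  apply (h.shortExact i).moduleCat_injective_f
  apply (hX i).eval.1
  change evaluation R S C (X i) ((h.ι i).hom x) = evaluation R S C (X i) ((h.ι i).hom y)
  rw [evaluation_map, evaluation_map, hxy]

/-- Push `φ : C → C ⊗ Z (i + 1)` into `C ⊗ X i`, where it is evaluation at some `x`. Injectivity of
evaluation on `Z i` forces `π x = 0`, so `x` comes from `Z (i + 1)`. -/
theorem evaluation_bijective (hX : ∀ i, IsAuslander R S C (X i)) (i : ℤ) :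
    Function.Bijective (evaluation R S C (Z i)) := by
  have hinj (i) : Function.Injective (evaluation R S C (Z i)) := by
    have := h.evaluation_injective hX (i - 1)
    rwa [sub_add_cancel] at this
  suffices hsurj : ∀ i, Function.Surjective (evaluation R S C (Z (i + 1))) by
    have := hsurj (i - 1)
    rw [sub_add_cancel] at this
    exact ⟨hinj i, this⟩
  intro i φ
  obtain ⟨x, hx⟩ := (hX i).eval.2 (biTensorMap R S C (h.ι i).hom ∘ₗ φ)
  have hπ : (h.π i).hom x = 0 := by
    apply hinj i
    rw [evaluation_map, hx, map_zero]
    ext c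
    exact (ShortComplex.moduleCat_zero_apply
      ((ShortComplex.mk (h.ι i) (h.π i) (h.zero i)).map (tensorFunctor R S C)) (φ c))
  obtain ⟨z, hz⟩ := ((ShortComplex.ShortExact.moduleCat_exact_iff_function_exact _).1
    (h.shortExact i).exact x).1 hπ
  refine ⟨z, LinearMap.ext fun c => h.injective_tensor i ?_⟩
  change (h.ι i).hom z = x at hz
  rw [← hz, evaluation_map] at hx
  exact LinearMap.congr_fun hx c

theorem subsingleton_ext_tensor (hX : ∀ i, IsAuslander R S C (X i)) (j : ℕ) (i : ℤ) :
    Subsingleton (Abelian.Ext (ModuleCat.of S C) ((tensorFunctor R S C).obj (Z i)) (j + 1)) := by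
  suffices key : ∀ i, Subsingleton (Abelian.Ext (ModuleCat.of S C)
      ((tensorFunctor R S C).obj (Z (i + 1))) (j + 1)) by
    have := key (i - 1)
    rwa [sub_add_cancel] at this
  clear i
  induction j with
  | zero =>
    intro i
    refine subsingleton_ext_one_of_forall_exists_lift (h.tensor_shortExact i) _
      ((hX i).ext 1 le_rfl) fun φ => ?_
    -- Every `φ` is evaluation at some `z`; evaluation at a preimage of `z` in `X i` is the desired
    -- lift.
    obtain ⟨z, hz⟩ := (h.evaluation_bijective hX i).2 φ.hom
    obtain ⟨x, rfl⟩ := (h.shortExact i).moduleCat_surjective_g z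
    exact ⟨ModuleCat.ofHom (evaluation R S C (X i) x), ModuleCat.hom_ext hz⟩
  | succ j ih =>
    intro i
    refine subsingleton_ext_succ_left (h.tensor_shortExact i) _ _
      ((hX i).ext (j + 1 + 1) (by omega)) ?_
    have := ih (i - 1)
    rwa [sub_add_cancel] at this

theorem isAuslander (hX : ∀ i, IsAuslander R S C (X i)) (i : ℤ) : IsAuslander R S C (Z i) where
  tor j hj := by
    obtain ⟨j, rfl⟩ := Nat.exists_eq_add_of_le' hj
    exact (isZero_leftDerived_iff R S C (Z i) j).2 (h.subsingleton_ext_characterDual hX j i)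
  ext j hj := by
    obtain ⟨j, rfl⟩ := Nat.exists_eq_add_of_le' hj
    exact h.subsingleton_ext_tensor hX j i
  eval := h.evaluation_bijective hX i

end TensorExactSyzygies

/-! ### Complete resolutions -/

theorem exact_of_acyclic {A : Type u} [Ring A] {K : ChainComplex (ModuleCat.{u} A) ℤ}
    (hK : K.Acyclic) (i : ℤ) :
    Function.Exact (K.d (i + 1) i).hom (K.d i (i - 1)).hom :=
  (ShortComplex.ShortExact.moduleCat_exact_iff_function_exact _).1
    ((K.exactAt_iff' (i + 1) i (i - 1) (by simp) (by simp)).1 (hK i))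

variable {R S C} in
/-- The syzygies of a `C ⊗_R -` exact acyclic complex. -/
def TensorExactSyzygies.ofAcyclic (X : ChainComplex (ModuleCat.{u} R) ℤ) (hX : X.Acyclic)
    (hCX : (((tensorFunctor R S C).mapHomologicalComplex (ComplexShape.down ℤ)).obj X).Acyclic) :
    TensorExactSyzygies R S C X.X (fun i => cokernel (X.d (i + 1) i)) :=
  have hπ (i : ℤ) : Function.Surjective (cokernel.π (X.d (i + 1) i)).hom :=
    (ModuleCat.epi_iff_surjective _).1 inferInstance
  have hdπ (i : ℤ) : Function.Exact (X.d (i + 1) i).hom (cokernel.π (X.d (i + 1) i)).hom :=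
    (ShortComplex.ShortExact.moduleCat_exact_iff_function_exact _).1
      (ShortComplex.exact_cokernel (X.d (i + 1) i))
  -- The differential factors through this cokernel; exactness of `X` makes the factor injective.
  let ι (i : ℤ) : cokernel (X.d (i + 1 + 1) (i + 1)) ⟶ X.X i :=
    cokernel.desc _ (X.d (i + 1) i) (X.d_comp_d _ _ _)
  have hι (i : ℤ) (x : X.X (i + 1)) :
      (ι i).hom ((cokernel.π (X.d (i + 1 + 1) (i + 1))).hom x) = (X.d (i + 1) i).hom x :=
    LinearMap.congr_fun (congrArg ModuleCat.Hom.hom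
      (cokernel.π_desc _ (X.d (i + 1) i) (X.d_comp_d _ _ _))) x
  have hCι (i : ℤ) (x : BiTensor R S C (X.X (i + 1))) :
      biTensorMap R S C (ι i).hom (biTensorMap R S C (cokernel.π (X.d (i + 1 + 1) (i + 1))).hom x) =
        biTensorMap R S C (X.d (i + 1) i).hom x := by
    induction x using biTensor_induction with
    | zero => simp only [map_zero]
    | tmul c m => simp only [biTensorMap_tmul, hι]
    | add x y hx hy => simp only [map_add, hx, hy]
  have hd (i : ℤ) : Function.Exact (X.d (i + 1 + 1) (i + 1)).hom (X.d (i + 1) i).hom := by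
    have := exact_of_acyclic hX (i + 1)
    rwa [add_sub_cancel_right] at this
  have hCd (i : ℤ) : Function.Exact (biTensorMap R S C (X.d (i + 1 + 1) (i + 1)).hom)
      (biTensorMap R S C (X.d (i + 1) i).hom) := by
    have := exact_of_acyclic hCX (i + 1)
    rw [add_sub_cancel_right] at this
    exact this
  have hz (i : ℤ) : ι i ≫ cokernel.π (X.d (i + 1) i) = 0 := by
    rw [← cancel_epi (cokernel.π _), cokernel.π_desc_assoc, cokernel.condition, comp_zero]
  { ι := ι
    π := fun i => cokernel.π (X.d (i + 1) i)
    zero := hz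
    shortExact := fun i => by
      refine ModuleCat.shortComplex_shortExact _ (fun x => ⟨fun hx => ?_, ?_⟩) ?_ (hπ i)
      · obtain ⟨y, rfl⟩ := (hdπ i x).1 hx
        exact ⟨_, hι i y⟩
      · rintro ⟨y, rfl⟩
        exact LinearMap.congr_fun (congrArg ModuleCat.Hom.hom (hz i)) y
      · refine (injective_iff_map_eq_zero (ι i).hom).2 fun y hy => ?_
        obtain ⟨x, rfl⟩ := hπ (i + 1) y
        rw [hι] at hy
        obtain ⟨w, rfl⟩ := (hd i x).1 hy
        exact (hdπ (i + 1)).apply_apply_eq_zero w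
    injective_tensor := fun i => by
      -- Lift `y` to a cycle `x` of the tensored complex. Exactness there makes `x` a boundary, and
      -- boundaries die in the tensored cokernel.
      refine (injective_iff_map_eq_zero (biTensorMap R S C (ι i).hom)).2 fun y hy => ?_
      obtain ⟨x, rfl⟩ := biTensorMap_surjective R S C (hπ (i + 1)) y
      have hx : biTensorMap R S C (X.d (i + 1) i).hom x = 0 := (hCι i x).symm.trans hy
      obtain ⟨w, rfl⟩ := (hCd i x).1 hx
      exact (biTensorMap_exact R S C (hdπ (i + 1)) (hπ (i + 1))).apply_apply_eq_zero w }

theorem completeCokernels_le_auslanderClass :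
    completeCokernels R S C (auslanderClass R S C) ≤ auslanderClass R S C := by
  rintro M ⟨X, hXA, hX, hCX, ⟨e⟩⟩
  exact ((TensorExactSyzygies.ofAcyclic X hX hCX).isAuslander hXA 0).of_iso R S C e.symm

/-- Stated for general `K` so that it serves both the two-term complex and its image under `C ⊗_R
-`. -/
theorem acyclic_of_isIso_d {𝒜 : Type*} [Category 𝒜] [Abelian 𝒜] (K : ChainComplex 𝒜 ℤ)
    (h : IsIso (K.d 0 (-1))) (hK : ∀ k, k ≠ 0 → k ≠ -1 → IsZero (K.X k)) : K.Acyclic := by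
  intro i
  by_cases h0 : i = 0
  · subst h0
    rw [K.exactAt_iff' 1 0 (-1) (by simp) (by simp)]
    refine (ShortComplex.exact_iff_mono _ ((hK 1 (by simp) (by simp)).eq_zero_of_src (K.d 1 0))).2 ?_
    exact inferInstanceAs (Mono (K.d 0 (-1)))
  by_cases h1 : i = -1
  · subst h1
    rw [K.exactAt_iff' 0 (-1) (-2) (by simp) (by simp)]
    refine (ShortComplex.exact_iff_epi _ ((hK (-2) (by simp) (by simp)).eq_zero_of_tgt (K.d (-1) (-2)))).2 ?_
    exact inferInstanceAs (Epi (K.d 0 (-1)))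
  exact HomologicalComplex.ExactAt.of_isZero (hK i h0 h1)

theorem auslanderClass_le_completeCokernels :
    auslanderClass R S C ≤ completeCokernels R S C (auslanderClass R S C) := by
  intro M hM
  have hrel : (ComplexShape.down ℤ).Rel 0 (-1) := by simp
  -- Degrees `0` and `-1` are chosen so that `X₁ = 0` and the cokernel of `X₁ → X₀` is `M`; in
  -- degrees `1` and `0` it would vanish.
  let X := HomologicalComplex.double (𝟙 M) hrel
  have h0 : IsZero (X.X 1) := HomologicalComplex.isZero_double_X _ _ _ (by simp) (by simp)
  have hd : IsIso (X.d 0 (-1)) := by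
    rw [HomologicalComplex.double_d (𝟙 M) hrel (by simp)]
    infer_instance
  have hz (k : ℤ) (hk : k ≠ 0) (hk' : k ≠ -1) : IsZero (X.X k) :=
    HomologicalComplex.isZero_double_X _ _ _ hk hk'
  refine ⟨X, fun i => ?_, acyclic_of_isIso_d X hd hz, acyclic_of_isIso_d _ ?_ ?_, ⟨?_⟩⟩
  · by_cases hi : i = 0
    · subst hi
      exact IsAuslander.of_iso R S C (HomologicalComplex.doubleXIso₀ (𝟙 M) hrel).symm hM
    by_cases hi' : i = -1
    · subst hi'
      exact IsAuslander.of_iso R S C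
        (HomologicalComplex.doubleXIso₁ (𝟙 M) hrel (by simp)).symm hM
    exact IsAuslander.of_isZero R S C (hz i hi hi')
  · exact inferInstanceAs (IsIso ((tensorFunctor R S C).map (X.d 0 (-1))))
  · intro k hk hk'
    exact (tensorFunctor R S C).map_isZero (hz k hk hk')
  · exact (HomologicalComplex.doubleXIso₀ (𝟙 M) hrel).symm ≪≫ cokernelZeroIsoTarget.symm ≪≫
      cokernelIsoOfEq (h0.eq_zero_of_src _).symm

/-- The Auslander class is stable under cokernels in `C ⊗_R -` exact complexes. This holds for every
`(S, R)`-bimodule `C`: the semidualizing conditions are not needed. -/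
theorem completeCokernels_auslanderClass :
    completeCokernels R S C (auslanderClass R S C) = auslanderClass R S C :=
  le_antisymm (completeCokernels_le_auslanderClass R S C)
    (auslanderClass_le_completeCokernels R S C)

end Bimodule

end Foxby

end

theorem theorem4p7 (R S C : Type u) [Ring R] [Ring S] [AddCommGroup C]
    [Module S C] [Module Rᵐᵒᵖ C] [SMulCommClass S Rᵐᵒᵖ C]
    (hC : Foxby.IsFaithfullySemidualizing R S C) (n : ℕ) (hn : 1 ≤ n) :
    Foxby.auslanderIterate R S C n = Foxby.auslanderClass R S C := by
  induction n, hn using Nat.le_induction with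
  | base => rfl
  | succ n hn ih =>
    -- The index becomes `n + 2`, where the recursive clause of `auslanderIterate` unfolds.
    obtain ⟨n, rfl⟩ := Nat.exists_eq_add_of_le' hn
    change Foxby.completeCokernels R S C (Foxby.auslanderIterate R S C (n + 1)) = _
    rw [ih, Foxby.completeCokernels_auslanderClass]
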